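/- Let $n\ge 0$ and let $\pi=\pi_1\cdots\pi_n$ be a $231$-avoiding permutation of $\{1,\dots,n\}$, i.e. there are no $i<j<k$ with $\pi_k<\pi_i<\pi_j$. **The Dyck path $\rho(\pi)$.** Put $\mathrm{Des}(\pi)=\{i<n:\pi_i>\pi_{i+1}\}\cup\{n\}=\{i_1<\dots<i_m\}$ and $\mathrm{iDes}(\pi)=\mathrm{Des}(\pi^{-1})=\{j_1<\dots<j_m\}$ (these two sets have the same cardinality since $\pi$ avoids $231$). With $i_0=j_0=0$, let $\rho(\pi)$ be the Dyck path $$0^{i_m-i_{m-1}}1^{j_m-j_{m-1}}\cdots 0^{i_2-i_1}1^{j_2-j_1}\,0^{i_1-i_0}1^{j_1-j_0},$$ where $0$ is an up step and $1$ a down step. For a word $f=f_1\cdots f_N$ in $0,1$, $\mathrm{maj}(f)$ is the sum of all $j$ with $1\le j\le N-1$ and $f_j>f_{j+1}$. **Dyck tilings.** Consider squares rotated by $45$ degrees with corners $(x\pm1,y),(x,y\pm1)$, where $(x,y)\in\mathbb Z^2$ is the centre and $x+y$ is odd. Let $R$ consist of those with $x\ge 0$, $y\ge 1$ and $x+y\le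 2n-1$; these are the squares above the zig-zag path $\lambda_b$ of $n$ up steps $(1,1)$ and $n$ down steps $(1,-1)$ taken alternately from $(0,0)$ to $(2n,0)$. A Dyck tile $d$ is a set of squares whose centres are the lattice points of a Dyck path (with steps $(1,1)$ and $(1,-1)$); it is trivial if it is a single square. A tiling $D$ of $R$ by Dyck tiles is cover-inclusive if every tile of $D$, translated by $(0,-2)$, is contained in a tile of $D$ or lies below $\lambda_b$. For $1\le i\le n$, the anchor box labelled $i$ is the square of $R$ with centre $(0,2(n-i)+1)$. The entry of a tile is the north-west edge of its left-most square, and its exit is the south-east edge of its right-most square. The trajectory of $i$ in a cover-inclusive tiling $D$ starts at the tile containing the anchor box labelled $i$, and passes from a tile to the next one as long as the exit of the former is the entry of the latter; let $u$ be the exit of the last tile, and write $i$ at the peak of $\lambda_b$ that ends the up step of $\lambda_b$ equal to $u$ or vertically below $u$. The labels of the peaks of $\lambda_b$, read from right to left, are the permutation of $D$. **Claim.** There is exactly one cover-inclusive Dyck tiling $D(\pi)$ of $R$ whose permutation is $\pi$. For a non-trivial tile $d$ consisting of $N(d)$ squares, whose left-most square has centre $(x(d),y(d))$, put $l(d)=(N(d)+1)/2$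 and $\mathrm{maj}(d)=l(d)+x(d)+(y(d)-1)/2$; for a trivial tile put $\mathrm{maj}(d)=0$. Then $$\mathrm{maj}(D(\pi)):=\sum_{d\in D(\pi)}\mathrm{maj}(d)=\mathrm{maj}(\rho(\pi)).$$ -/

import Mathlib

namespace DyckTiling

/-- The major index of a word `f = f₁ … f_m`: the sum of all `j` with `1 ≤ j ≤ m - 1` and
`f_j > f_{j+1}` (in the code `j` is counted from `0`). -/
def majorIndex (f : List ℕ) : ℕ :=
  ∑ j ∈ (Finset.range f.length).filter (fun j => ∃ h : j + 1 < f.length, f[j + 1] < f[j]), (j + 1)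

/-! ### Permutations and the Dyck path `ρ(π)`

A permutation `π : Equiv.Perm (Fin n)` has the one-line notation `π₁ … π_n` with
`π_{k+1} = π k + 1`. -/

def Avoids231 {n : ℕ} (π : Equiv.Perm (Fin n)) : Prop :=
  ¬ ∃ i j k : Fin n, i < j ∧ j < k ∧ π k < π i ∧ π i < π j

/-- `Des(π) = {i : π_i > π_{i+1}} ∪ {n}`, with positions counted from `1`. -/
def des {n : ℕ} (π : Equiv.Perm (Fin n)) : Finset ℕ :=
  insert n ((Finset.univ.filter fun i : Fin n =>
    ∃ h : (i : ℕ) + 1 < n, π ⟨(i : ℕ) + 1, h⟩ < π i).image fun i : Fin n => (i : ℕ) + 1)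

def iDes {n : ℕ} (π : Equiv.Perm (Fin n)) : Finset ℕ := des π⁻¹

/-- For `is = (i₁, i₂, …)`, `js = (j₁, j₂, …)` the word
`⋯ 0^{i₂ - i₁} 1^{j₂ - j₁} 0^{i₁ - a} 1^{j₁ - b}`, built from right to left. -/
def pathWord : (a b : ℕ) → (is js : List ℕ) → List ℕ
  | a, b, i :: is, j :: js =>
      pathWord i j is js ++ (List.replicate (i - a) 0 ++ List.replicate (j - b) 1)
  | _, _, _, _ => []

/-- The Dyck path `ρ(π)` as a word in `0` (up) and `1` (down). -/
def rho {n : ℕ} (π : Equiv.Perm (Fin n)) : List ℕ :=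
  pathWord 0 0 ((des π).sort (· ≤ ·)) ((iDes π).sort (· ≤ ·))

/-! ### Dyck tiles and Dyck tilings

The unit squares are rotated by 45 degrees; a square is represented by its centre `(x, y)`, so
that its corners are `(x ± 1, y)` and `(x, y ± 1)`. -/

/-- The centres of the squares in the region `R` above the zig-zag path `(01)^n` from `(0, 0)` to
`(2n, 0)` and below the line from `(0, 2n)` to `(2n, 0)`, beginning at `x = 0`. -/
def region (n : ℕ) : Set (ℤ × ℤ) :=
  {p | 0 ≤ p.1 ∧ 1 ≤ p.2 ∧ p.1 + p.2 ≤ 2 * n - 1 ∧ Odd (p.1 + p.2)}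

/-- A Dyck tile: the squares whose centres lie on the Dyck path `path` starting at `(x, y)`. -/
structure DyckTile where
  x : ℤ
  y : ℤ
  path : DyckWord

namespace DyckTile

def boxes (d : DyckTile) : Finset (ℤ × ℤ) :=
  (Finset.range (d.path.toList.length + 1)).image fun j : ℕ =>
    (d.x + (j : ℤ), d.y + (((d.path.toList.take j).count DyckStep.U : ℤ)
      - ((d.path.toList.take j).count DyckStep.D : ℤ)))

/-- The size `l(d)`: zero for a trivial tile (a unit square), and `(N(d) + 1) / 2` for a
non-trivial tile of `N(d)` squares. -/
def size (d : DyckTile) : ℚ :=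
  if d.path = 0 then 0 else ((d.boxes.card : ℚ) + 1) / 2

def maj (d : DyckTile) : ℚ :=
  if d.path = 0 then 0 else d.size + (d.x : ℚ) + ((d.y : ℚ) - 1) / 2

/-- The left-most up step on the boundary of the tile, the north-west edge of its left-most
square. An up step from `(a, b)` to `(a + 1, b + 1)` is represented by `(a, b)`. -/
def entry (d : DyckTile) : ℤ × ℤ := (d.x - 1, d.y)

/-- The right-most up step on the boundary of the tile, the south-east edge of its right-most
square `(x + 2 * semilength, y)`. -/
def exit (d : DyckTile) : ℤ × ℤ := (d.x + 2 * (d.path.semilength : ℤ), d.y - 1)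

end DyckTile

/-- `D` is a cover-inclusive Dyck tiling of `R`. A square with centre `(x, y)` lies below the
zig-zag path if and only if `y ≤ 0`. -/
structure IsCoverInclusiveTiling (n : ℕ) (D : Finset DyckTile) : Prop where
  disjoint : ∀ d ∈ D, ∀ d' ∈ D, d ≠ d' → Disjoint d.boxes d'.boxes
  cover : (⋃ d ∈ D, (d.boxes : Set (ℤ × ℤ))) = region n
  inclusive : ∀ d ∈ D,
    (∃ d' ∈ D, ∀ b ∈ d.boxes, (b.1, b.2 - 2) ∈ d'.boxes) ∨ (∀ b ∈ d.boxes, b.2 - 2 ≤ 0)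

def tilingMaj (D : Finset DyckTile) : ℚ := ∑ d ∈ D, d.maj

/-- The trajectory passes from `d` to `d'`: the exit of `d` is the entry of `d'`. -/
def Step (D : Finset DyckTile) (d d' : DyckTile) : Prop :=
  d ∈ D ∧ d' ∈ D ∧ d.exit = d'.entry

/-- The trajectory that starts at the anchor box labelled `i + 1`, whose centre is
`(0, 2 (n - i) - 1)`, leaves its last tile through the up step `u`: the exit `u` of that tile is
not the entry of any tile of `D`, so it is an up step of the zig-zag path or an up step, not an
entry, of another tile. -/
def TrajectoryEndsAt (n : ℕ) (D : Finset DyckTile) (i : Fin n) (u : ℤ × ℤ) : Prop :=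
  ∃ d₀ ∈ D, d₀.x = 0 ∧ d₀.y = 2 * ((n : ℤ) - (i : ℤ)) - 1 ∧
    ∃ d, Relation.ReflTransGen (Step D) d₀ d ∧ d.exit = u ∧ ∀ d' ∈ D, d'.entry ≠ u

/-- `π` is the permutation of the tiling `D`: for every `k` the trajectory of the label `π_{k+1}`
ends at an up step `u` from `(a, b)` to `(a + 1, b + 1)` on or above the up step of the zig-zag
path that leads to its `(k + 1)`-st peak from the right, which is `(2 (n - k) - 1, 1)`. -/
def HasPermutation {n : ℕ} (D : Finset DyckTile) (π : Equiv.Perm (Fin n)) : Prop :=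
  ∀ k : Fin n, ∃ u : ℤ × ℤ,
    TrajectoryEndsAt n D (π k) u ∧ u.1 + 1 = 2 * ((n : ℤ) - (k : ℤ)) - 1

end DyckTiling

namespace DyckTiling

/-! Cover-inclusiveness over a zig-zag path forces every tile to be a zig-zag of height at most one,
so a tiling is recorded by its links: the places where neighbouring boxes of a row are bottom boxes
of one tile. Links occur only in odd rows and odd columns, and they are closed under moving down two
rows. Hence a tiling amounts to one number per odd column, the height of its stack of links.

A trajectory crosses the odd columns from left to right. At a link it keeps its row. Otherwise it
drops by two rows through a trivial tile, unless a link just below stops it. Following all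
trajectories (`TiledBy.reaches_column`) shows that the tiling has permutation `π` exactly when the
column of position `q` holds `invCount π q` links, the Lehmer code of `π`. This gives existence
(`TiledBy.hasPermutation`) and uniqueness (`TiledBy.link_eq_permLink`).

When `π` avoids 231, the code rises by exactly one at each descent, so the non-trivial tiles
correspond to the descents. With positions and values counted from 0, the right end of the tile of
the descent `i` is given by `i` and its left end by `π i` (`IsTileOf.exists_descent`), and its maj
is `(n - 1 - i) + (n - π i)`. On the other side, the valleys of `ρ(π)` sit at the positions `(n -
i_t) + (n - j_t)`, and the inverse descents are the descent tops lowered by one (`iDes_eq`), so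
`majorIndex_rho` yields the same sum. -/

/-! ### Zig-zag words and zig-zag tiles. -/

/-- The zig-zag Dyck word `(UD)^k`. -/
def zig : ℕ → DyckWord
  | 0 => 0
  | k + 1 => DyckWord.nest 0 + zig k

lemma zig_succ_toList (k : ℕ) :
    (zig (k + 1)).toList = DyckStep.U :: DyckStep.D :: (zig k).toList := rfl

lemma length_zig (k : ℕ) : (zig k).toList.length = 2 * k := by
  induction k with
  | zero => rfl
  | succ k ih => rw [zig_succ_toList]; simp [ih]; ring

lemma semilength_zig (k : ℕ) : (zig k).semilength = k := by
  have := (zig k).two_mul_semilength_eq_length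
  rw [length_zig] at this
  omega

lemma zig_injective : Function.Injective zig := fun a b h => by
  rw [← semilength_zig a, h, semilength_zig]

lemma height_take_zig (k j : ℕ) (hj : j ≤ 2 * k) :
    (((zig k).toList.take j).count DyckStep.U : ℤ) - (((zig k).toList.take j).count DyckStep.D : ℤ)
      = ((j % 2 : ℕ) : ℤ) := by
  induction k generalizing j with
  | zero =>
    obtain rfl : j = 0 := by omega
    simp
  | succ k ih =>
    match j with
    | 0 => simp
    | 1 => simp [zig_succ_toList]
    | j + 2 =>
      have := ih j (by omega)
      rw [zig_succ_toList]
      simp only [List.take_succ_cons, List.count_cons]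
      simp
      omega

/-- A word of height at most one is a zig-zag word. -/
lemma exists_eq_zig_toList : ∀ l : List DyckStep,
    (∀ j, (l.take j).count DyckStep.D ≤ (l.take j).count DyckStep.U) →
    (∀ j, (l.take j).count DyckStep.U ≤ (l.take j).count DyckStep.D + 1) →
    l.count DyckStep.U = l.count DyckStep.D → ∃ k, l = (zig k).toList
  | [], _, _, _ => ⟨0, rfl⟩
  | [DyckStep.U], _, _, h => by simp at h
  | [DyckStep.D], _, _, h => by simp at h
  | s :: s' :: l, h1, h2, h3 => by
    have a1 := h1 1
    have a2 := h2 2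
    have hs : s = DyckStep.U := by cases s <;> simp_all
    subst hs
    have hs' : s' = DyckStep.D := by cases s' <;> simp_all
    subst hs'
    obtain ⟨k, hk⟩ := exists_eq_zig_toList l
      (fun j => by have := h1 (j + 2); simp at this; omega)
      (fun j => by have := h2 (j + 2); simp at this; omega)
      (by simp at h3; omega)
    exact ⟨k + 1, by rw [zig_succ_toList, hk]⟩

namespace DyckTile

lemma ext_of {d d' : DyckTile} (hx : d.x = d'.x) (hy : d.y = d'.y) (hp : d.path = d'.path) :
    d = d' := by
  cases d; cases d'; simp_all

lemma mem_boxes_zig {d : DyckTile} {k : ℕ} (hd : d.path = zig k) (X Y : ℤ) :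
    (X, Y) ∈ d.boxes ↔
      (∃ i : ℕ, i ≤ k ∧ X = d.x + 2 * i ∧ Y = d.y) ∨
      (∃ i : ℕ, i < k ∧ X = d.x + 2 * i + 1 ∧ Y = d.y + 1) := by
  simp only [boxes, hd, Finset.mem_image, Finset.mem_range, length_zig, Prod.mk.injEq]
  constructor
  · rintro ⟨j, hj, h1, h2⟩
    rw [height_take_zig k j (by omega)] at h2
    rcases Nat.even_or_odd' j with ⟨i, rfl | rfl⟩
    · left; refine ⟨i, ?_, ?_, ?_⟩ <;> omega
    · right; refine ⟨i, ?_, ?_, ?_⟩ <;> omega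
  · rintro (⟨i, hi, rfl, rfl⟩ | ⟨i, hi, rfl, rfl⟩)
    · refine ⟨2 * i, by omega, by push_cast; ring, ?_⟩
      rw [height_take_zig k _ (by omega)]; omega
    · refine ⟨2 * i + 1, by omega, by push_cast; ring, ?_⟩
      rw [height_take_zig k _ (by omega)]; omega

lemma card_boxes (d : DyckTile) : d.boxes.card = d.path.toList.length + 1 := by
  rw [boxes, Finset.card_image_of_injective, Finset.card_range]
  intro a b h
  simp only [Prod.mk.injEq] at h
  omega

lemma corner_mem_boxes (d : DyckTile) : (d.x, d.y) ∈ d.boxes := by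
  simp only [boxes, Finset.mem_image, Finset.mem_range]
  exact ⟨0, by omega, by simp⟩

lemma le_of_mem_boxes (d : DyckTile) {b : ℤ × ℤ} (hb : b ∈ d.boxes) : d.y ≤ b.2 := by
  simp only [boxes, Finset.mem_image, Finset.mem_range] at hb
  obtain ⟨j, -, rfl⟩ := hb
  have := d.path.count_D_le_count_U j
  simp only
  omega

lemma exists_eq_zig_of_le (d : DyckTile) (h : ∀ b ∈ d.boxes, b.2 ≤ d.y + 1) :
    ∃ k, d.path = zig k := by
  obtain ⟨k, hk⟩ := exists_eq_zig_toList d.path.toList d.path.count_D_le_count_U (fun j => by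
      rcases le_or_gt j d.path.toList.length with hj | hj
      · have := h _ (Finset.mem_image_of_mem _ (Finset.mem_range.2 (Nat.lt_succ_of_le hj)))
        simp only at this
        omega
      · rw [List.take_of_length_le hj.le]
        have := d.path.count_U_eq_count_D
        omega) d.path.count_U_eq_count_D
  exact ⟨k, DyckWord.ext hk⟩

/-- A non-trivial tile contains the box north-east of its left-most box. -/
lemma second_mem_boxes (d : DyckTile) (h : d.path ≠ 0) : (d.x + 1, d.y + 1) ∈ d.boxes := by
  have hl : d.path.toList ≠ [] := fun h0 => h (DyckWord.ext h0)
  obtain ⟨s, l, hsl⟩ := List.exists_cons_of_ne_nil hl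
  have h1 := d.path.count_D_le_count_U 1
  have hs : s = DyckStep.U := by cases s <;> simp_all
  subst hs
  simp only [boxes, Finset.mem_image, Finset.mem_range]
  exact ⟨1, by simp [hsl], by simp [hsl]⟩

end DyckTile

/-! ### Tiles of a cover-inclusive tiling have height at most one. -/

lemma IsCoverInclusiveTiling.mem_region {n : ℕ} {D : Finset DyckTile}
    (h : IsCoverInclusiveTiling n D) {d : DyckTile} (hd : d ∈ D) {b : ℤ × ℤ} (hb : b ∈ d.boxes) :
    b ∈ region n := by
  rw [← h.cover]
  simp only [Set.mem_iUnion]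
  exact ⟨d, hd, hb⟩

lemma IsCoverInclusiveTiling.exists_mem {n : ℕ} {D : Finset DyckTile}
    (h : IsCoverInclusiveTiling n D) {b : ℤ × ℤ} (hb : b ∈ region n) : ∃ d ∈ D, b ∈ d.boxes := by
  rw [← h.cover] at hb
  simpa using hb

lemma IsCoverInclusiveTiling.eq_of_mem {n : ℕ} {D : Finset DyckTile}
    (h : IsCoverInclusiveTiling n D) {d d' : DyckTile} (hd : d ∈ D) (hd' : d' ∈ D) {b : ℤ × ℤ}
    (hb : b ∈ d.boxes) (hb' : b ∈ d'.boxes) : d = d' := by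
  by_contra hne
  exact Finset.disjoint_left.1 (h.disjoint d hd d' hd' hne) hb hb'

/-- A non-trivial tile has boxes in its rows `y` and `y + 1`. If the tile below containing its
translate has height at most one, its base row must be `y - 2`, and the height bound passes upwards.
A tile whose translate lies below the path has all its boxes in rows 1 and 2. -/
lemma IsCoverInclusiveTiling.box_le {n : ℕ} {D : Finset DyckTile}
    (h : IsCoverInclusiveTiling n D) (N : ℕ) : ∀ d ∈ D, d.y ≤ N → ∀ b ∈ d.boxes, b.2 ≤ d.y + 1 := by
  induction N with
  | zero =>
    intro d hd hN
    have := (h.mem_region hd d.corner_mem_boxes).2.1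
    simp only at this
    omega
  | succ N ih =>
    intro d hd hN b hb
    have hy := (h.mem_region hd d.corner_mem_boxes).2.1
    simp only at hy
    rcases h.inclusive d hd with ⟨d', hd', hsub⟩ | hlow
    · have h0 := hsub _ d.corner_mem_boxes
      have h0' := d'.le_of_mem_boxes h0
      simp only at h0'
      have hle := ih d' hd' (by push_cast at hN; omega)
      by_cases hp : d.path = 0
      · rcases (DyckTile.mem_boxes_zig (k := 0) hp b.1 b.2).1 hb with ⟨_, _, _, h⟩ | ⟨_, h, _⟩ <;>
          omega
      · have h1 := hle _ (hsub _ (d.second_mem_boxes hp))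
        have h2 := hle _ (hsub _ hb)
        simp only at h1 h2
        omega
    · have := hlow b hb
      omega

lemma IsCoverInclusiveTiling.exists_eq_zig {n : ℕ} {D : Finset DyckTile}
    (h : IsCoverInclusiveTiling n D) {d : DyckTile} (hd : d ∈ D) : ∃ k, d.path = zig k :=
  d.exists_eq_zig_of_le (h.box_le d.y.toNat d hd (Int.self_le_toNat _))

/-! ### Link systems and the tilings they define. -/

/-- `L m y` records that the boxes `(m - 1, y)` and `(m + 1, y)` lie, as bottom boxes, in the same
tile. These are the properties of this relation for a cover-inclusive tiling. -/
structure LinkSystem (n : ℕ) (L : ℤ → ℤ → Prop) : Prop where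
  bounds : ∀ {m y}, L m y → 1 ≤ m ∧ 1 ≤ y ∧ m + y ≤ 2 * n - 2 ∧ Odd m ∧ Odd y
  down : ∀ {m y}, L m y → 3 ≤ y → L m (y - 2)

lemma LinkSystem.not_link_succ {n : ℕ} {L : ℤ → ℤ → Prop} (hL : LinkSystem n L) {m m' y : ℤ}
    (h : L m y) : ¬ L m' (y + 1) := fun h' => by
  have h1 := (hL.bounds h).2.2.2.2
  have h2 := (hL.bounds h').2.2.2.2
  rw [Int.odd_iff] at h1 h2
  omega

/-- `d` is the zig-zag tile formed by a maximal chain of `k` links. -/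
structure IsTileOf (n : ℕ) (L : ℤ → ℤ → Prop) (k : ℕ) (d : DyckTile) : Prop where
  path_eq : d.path = zig k
  left_mem : (d.x, d.y) ∈ region n
  right_mem : (d.x + 2 * k, d.y) ∈ region n
  link : ∀ i < k, L (d.x + 2 * i + 1) d.y
  not_link_left : ¬ L (d.x - 1) d.y
  not_link_right : ¬ L (d.x + 2 * k + 1) d.y
  not_top : ¬ L d.x (d.y - 1)

namespace IsTileOf

variable {n : ℕ} {L : ℤ → ℤ → Prop} {k k' : ℕ} {d d' : DyckTile}

lemma mem_boxes (h : IsTileOf n L k d) (X Y : ℤ) :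
    (X, Y) ∈ d.boxes ↔
      (∃ i : ℕ, i ≤ k ∧ X = d.x + 2 * i ∧ Y = d.y) ∨
      (∃ i : ℕ, i < k ∧ X = d.x + 2 * i + 1 ∧ Y = d.y + 1) :=
  DyckTile.mem_boxes_zig h.path_eq X Y

lemma exit_eq (h : IsTileOf n L k d) : d.exit = (d.x + 2 * k, d.y - 1) := by
  rw [DyckTile.exit, h.path_eq, semilength_zig]

lemma bottom_mem (h : IsTileOf n L k d) {i : ℕ} (hi : i ≤ k) : (d.x + 2 * i, d.y) ∈ d.boxes :=
  (h.mem_boxes _ _).2 (.inl ⟨i, hi, rfl, rfl⟩)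

lemma top_mem (h : IsTileOf n L k d) {i : ℕ} (hi : i < k) :
    (d.x + 2 * i + 1, d.y + 1) ∈ d.boxes :=
  (h.mem_boxes _ _).2 (.inr ⟨i, hi, rfl, rfl⟩)

lemma not_link_below (hL : LinkSystem n L) (h : IsTileOf n L k d) {i : ℕ} (hi : i ≤ k) :
    ¬ L (d.x + 2 * i) (d.y - 1) := by
  intro hl
  rcases Nat.eq_zero_or_pos i with rfl | hpos
  · exact h.not_top (by simpa using hl)
  · have h1 := h.link (i - 1) (by omega)
    refine hL.not_link_succ (m' := d.x + 2 * (i - 1 : ℕ) + 1) hl ?_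
    convert h1 using 1
    ring

lemma mem_region (h : IsTileOf n L k d) {b : ℤ × ℤ} (hb : b ∈ d.boxes) :
    b ∈ region n := by
  obtain ⟨X, Y⟩ := b
  have h1 := h.left_mem
  have h2 := h.right_mem
  simp only [region, Set.mem_ofPred_eq, Int.odd_iff] at *
  rcases (h.mem_boxes X Y).1 hb with ⟨i, hi, rfl, rfl⟩ | ⟨i, hi, rfl, rfl⟩ <;> omega

lemma eq_of_bottom (h : IsTileOf n L k d) (h' : IsTileOf n L k' d') {i i' : ℕ} (hi : i ≤ k)
    (hi' : i' ≤ k') (hx : d.x + 2 * i = d'.x + 2 * i') (hy : d.y = d'.y) : d = d' := by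
  have aux : ∀ {k k' : ℕ} {d d' : DyckTile}, IsTileOf n L k d → IsTileOf n L k' d' →
      ∀ {i i' : ℕ}, i ≤ k → i' ≤ k' → d.x + 2 * i = d'.x + 2 * i' → d.y = d'.y →
      i ≤ i' ∧ k - i ≤ k' - i' := by
    intro k k' d d' h h' i i' hi hi' hx hy
    constructor
    · by_contra hlt
      have := h.link (i - i' - 1) (by omega)
      apply h'.not_link_left
      convert this using 1
      · omega
      · exact hy.symm
    · by_contra hlt
      have := h.link (i + (k' - i')) (by omega)
      apply h'.not_link_right
      convert this using 1
      · omega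
      · exact hy.symm
  have a1 := aux h h' hi hi' hx hy
  have a2 := aux h' h hi' hi hx.symm hy.symm
  have hk : k = k' := by omega
  subst hk
  exact DyckTile.ext_of (by omega) hy (h.path_eq.trans h'.path_eq.symm)

/-- A bottom box of one tile is never the top box of a link of another, so a shared box is a bottom
box of both or a top box of both. Maximality of the chains then forces equality. -/
lemma eq_of_mem (hL : LinkSystem n L) (h : IsTileOf n L k d) (h' : IsTileOf n L k' d')
    {b : ℤ × ℤ} (hb : b ∈ d.boxes) (hb' : b ∈ d'.boxes) : d = d' := by
  obtain ⟨X, Y⟩ := b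
  rcases (h.mem_boxes X Y).1 hb with ⟨i, hi, hX, hY⟩ | ⟨i, hi, hX, hY⟩ <;>
    rcases (h'.mem_boxes X Y).1 hb' with ⟨i', hi', hX', hY'⟩ | ⟨i', hi', hX', hY'⟩
  · exact h.eq_of_bottom h' hi hi' (by omega) (by omega)
  · exfalso
    apply h.not_link_below hL hi
    convert h'.link i' hi' using 1 <;> omega
  · exfalso
    apply h'.not_link_below hL hi'
    convert h.link i hi using 1 <;> omega
  · exact h.eq_of_bottom h' hi.le hi'.le (by omega) (by omega)

end IsTileOf

/-- Every box that is not the top box of a link is a bottom box of a tile. -/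
lemma LinkSystem.exists_tile_bottom {n : ℕ} {L : ℤ → ℤ → Prop} (hL : LinkSystem n L) {X Y : ℤ}
    (hr : (X, Y) ∈ region n) (hn : ¬ L X (Y - 1)) :
    ∃ k d i, IsTileOf n L k d ∧ i ≤ k ∧ X = d.x + 2 * (i : ℕ) ∧ Y = d.y := by
  classical
  -- The tile is the maximal run of links through the box; both directions stop because links stay
  -- in a bounded range.
  have el : ∃ i : ℕ, ¬ L (X - 2 * i - 1) Y := ⟨X.toNat, fun h => by
    have := (hL.bounds h).1; omega⟩
  have er : ∃ i : ℕ, ¬ L (X + 2 * i + 1) Y := ⟨(2 * n : ℕ), fun h => by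
    have := hL.bounds h
    have := hr.1
    simp only at this
    push_cast at *
    omega⟩
  obtain ⟨i, hi, hi'⟩ : ∃ i : ℕ, ¬ L (X - 2 * i - 1) Y ∧ ∀ j < i, L (X - 2 * j - 1) Y :=
    ⟨Nat.find el, Nat.find_spec el, fun j hj => not_not.1 (Nat.find_min el hj)⟩
  obtain ⟨k, hk, hk'⟩ : ∃ i : ℕ, ¬ L (X + 2 * i + 1) Y ∧ ∀ j < i, L (X + 2 * j + 1) Y :=
    ⟨Nat.find er, Nat.find_spec er, fun j hj => not_not.1 (Nat.find_min er hj)⟩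
  simp only [region, Set.mem_ofPred_eq, Int.odd_iff] at hr
  refine ⟨i + k, ⟨X - 2 * i, Y, zig (i + k)⟩, i, ⟨rfl, ?_, ?_, ?_, ?_, ?_, ?_⟩, by omega, by simp,
    rfl⟩
  · simp only [region, Set.mem_ofPred_eq, Int.odd_iff]
    rcases Nat.eq_zero_or_pos i with rfl | hpos
    · simp; omega
    · have := hL.bounds (hi' (i - 1) (by omega))
      omega
  · simp only [region, Set.mem_ofPred_eq, Int.odd_iff]
    rcases Nat.eq_zero_or_pos k with rfl | hpos
    · push_cast; omega
    · have := hL.bounds (hk' (k - 1) (by omega))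
      push_cast; omega
  · intro j hj
    rcases lt_or_ge j i with h | h
    · convert hi' (i - 1 - j) (by omega) using 1
      simp only; omega
    · convert hk' (j - i) (by omega) using 1
      simp only; omega
  · exact hi
  · convert hk using 2
    push_cast; ring
  · rcases Nat.eq_zero_or_pos i with rfl | hpos
    · simpa using hn
    · intro hl
      refine hL.not_link_succ (m' := X - 2 * (i - 1 : ℕ) - 1) hl ?_
      convert hi' (i - 1) (by omega) using 1
      simp

lemma LinkSystem.exists_tile {n : ℕ} {L : ℤ → ℤ → Prop} (hL : LinkSystem n L) {b : ℤ × ℤ}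
    (hr : b ∈ region n) : ∃ k d, IsTileOf n L k d ∧ b ∈ d.boxes := by
  obtain ⟨X, Y⟩ := b
  by_cases hl : L X (Y - 1)
  · have hb := hL.bounds hl
    obtain ⟨k, d, i, hd, hi, hX, hY⟩ := hL.exists_tile_bottom (X := X - 1) (Y := Y - 1) (by
      simp only [region, Set.mem_ofPred_eq, Int.odd_iff] at *
      omega) (fun h => by
        have := hL.not_link_succ (m' := X) h
        exact this (by convert hl using 1; ring))
    refine ⟨k, d, hd, ?_⟩
    have hik : i < k := by
      refine lt_of_le_of_ne hi fun h => ?_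
      subst h
      apply hd.not_link_right
      convert hl using 1 <;> omega
    convert hd.top_mem hik using 2 <;> omega
  · obtain ⟨k, d, i, hd, hi, rfl, rfl⟩ := hL.exists_tile_bottom hr hl
    exact ⟨k, d, hd, hd.bottom_mem hi⟩

lemma LinkSystem.finite_tiles {n : ℕ} {L : ℤ → ℤ → Prop} :
    {d | ∃ k, IsTileOf n L k d}.Finite := by
  refine (((Set.finite_Icc (0 : ℤ) (2 * n)).prod
    ((Set.finite_Icc (0 : ℤ) (2 * n)).prod (Set.finite_Iic (2 * n : ℕ)))).image
      (fun p => (⟨p.1, p.2.1, zig p.2.2⟩ : DyckTile))).subset ?_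
  rintro d ⟨k, hd⟩
  refine ⟨(d.x, d.y, k), ?_, DyckTile.ext_of rfl rfl hd.path_eq.symm⟩
  have h1 := hd.left_mem
  have h2 := hd.right_mem
  simp only [region, Set.mem_ofPred_eq, Set.mem_prod, Set.mem_Icc, Set.mem_Iic] at *
  omega

/-- The tiling `D` consists of the tiles given by the links `L`. -/
def TiledBy (n : ℕ) (L : ℤ → ℤ → Prop) (D : Finset DyckTile) : Prop :=
  ∀ d, d ∈ D ↔ ∃ k, IsTileOf n L k d

lemma exists_tiledBy (n : ℕ) (L : ℤ → ℤ → Prop) : ∃ D, TiledBy n L D :=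
  ⟨(LinkSystem.finite_tiles (n := n) (L := L)).toFinset, fun d => by simp⟩

/-- Since links are closed under moving down two rows, the translate of a chain is part of a single
maximal chain. The translate of a trivial tile is one box, which any covering tile contains. -/
lemma TiledBy.isCoverInclusiveTiling {n : ℕ} {L : ℤ → ℤ → Prop} {D : Finset DyckTile}
    (hL : LinkSystem n L) (hD : TiledBy n L D) : IsCoverInclusiveTiling n D where
  disjoint d hd d' hd' hne := by
    obtain ⟨k, hk⟩ := (hD d).1 hd
    obtain ⟨k', hk'⟩ := (hD d').1 hd'
    exact Finset.disjoint_left.2 fun b hb hb' => hne (hk.eq_of_mem hL hk' hb hb')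
  cover := by
    ext b
    simp only [Set.mem_iUnion]
    constructor
    · rintro ⟨d, hd, hb⟩
      obtain ⟨k, hk⟩ := (hD d).1 hd
      exact hk.mem_region hb
    · intro hb
      obtain ⟨k, d, hd, hb⟩ := hL.exists_tile hb
      exact ⟨d, (hD d).2 ⟨k, hd⟩, hb⟩
  inclusive d hd := by
    obtain ⟨k, hk⟩ := (hD d).1 hd
    have hr := hk.left_mem
    simp only [region, Set.mem_ofPred_eq, Int.odd_iff] at hr
    rcases Nat.eq_zero_or_pos k with rfl | hpos
    · have hbox : ∀ b ∈ d.boxes, b = (d.x, d.y) := by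
        rintro ⟨X, Y⟩ hb
        rcases (hk.mem_boxes X Y).1 hb with ⟨i, hi, h1, h2⟩ | ⟨i, hi, _⟩
        · obtain rfl : i = 0 := by omega
          simp [h1, h2]
        · omega
      rcases le_or_gt d.y 2 with hy | hy
      · right
        intro b hb
        rw [hbox b hb]
        simp only
        omega
      · left
        obtain ⟨k', d', hd', hm⟩ := hL.exists_tile (b := (d.x, d.y - 2)) (by
          simp only [region, Set.mem_ofPred_eq, Int.odd_iff]; omega)
        refine ⟨d', (hD d').2 ⟨k', hd'⟩, fun b hb => ?_⟩
        rw [hbox b hb]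
        exact hm
    · rcases le_or_gt d.y 2 with hy | hy
      · have h1 : d.y = 1 := by
          have := (hL.bounds (hk.link 0 hpos)).2.2.2.2
          rw [Int.odd_iff] at this
          omega
        right
        rintro ⟨X, Y⟩ hb
        rcases (hk.mem_boxes X Y).1 hb with ⟨i, hi, rfl, rfl⟩ | ⟨i, hi, rfl, rfl⟩ <;> simp only <;>
          omega
      · left
        obtain ⟨k', d', i', hd', hi', hX, hY⟩ := hL.exists_tile_bottom (X := d.x) (Y := d.y - 2) (by
            simp only [region, Set.mem_ofPred_eq, Int.odd_iff]; omega) (fun h => by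
            have h1 := hL.down (hk.link 0 hpos) (by omega)
            refine hL.not_link_succ (m' := d.x + 2 * (0 : ℕ) + 1) h ?_
            convert h1 using 1
            ring)
        have hlink : ∀ i < k, L (d'.x + 2 * (i' + i : ℕ) + 1) d'.y := fun i hi => by
          convert hL.down (hk.link i hi) (by omega) using 1
          · push_cast; omega
          · omega
        have hkk : ∀ i ≤ k, i' + i ≤ k' := by
          intro i
          induction i with
          | zero => intro _; omega
          | succ i ih =>
            intro hi
            have := ih (by omega)
            by_contra hgt
            obtain rfl : i' + i = k' := by omega
            exact hd'.not_link_right (hlink i (by omega))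
        refine ⟨d', (hD d').2 ⟨k', hd'⟩, ?_⟩
        rintro ⟨X, Y⟩ hb
        rw [hd'.mem_boxes]
        rcases (hk.mem_boxes X Y).1 hb with ⟨i, hi, rfl, rfl⟩ | ⟨i, hi, rfl, rfl⟩
        · exact .inl ⟨i' + i, hkk i hi, by push_cast; omega, by omega⟩
        · exact .inr ⟨i' + i, hkk (i + 1) hi, by push_cast; omega, by omega⟩

/-! ### The links of a given tiling. -/

/-- The links of a tiling. -/
def tilingLink (D : Finset DyckTile) (m y : ℤ) : Prop :=
  ∃ d ∈ D, d.y = y ∧ (m, y + 1) ∈ d.boxes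

namespace IsCoverInclusiveTiling

variable {n : ℕ} {D : Finset DyckTile}

lemma link_iff (h : IsCoverInclusiveTiling n D) {m y : ℤ} :
    tilingLink D m y ↔ ∃ d ∈ D, ∃ k i : ℕ, d.path = zig k ∧ i < k ∧ m = d.x + 2 * i + 1 ∧
      y = d.y := by
  constructor
  · rintro ⟨d, hd, rfl, hb⟩
    obtain ⟨k, hk⟩ := h.exists_eq_zig hd
    rcases (DyckTile.mem_boxes_zig hk _ _).1 hb with ⟨i, _, _, _⟩ | ⟨i, hi, hm, _⟩
    · omega
    · exact ⟨d, hd, k, i, hk, hi, hm, rfl⟩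
  · rintro ⟨d, hd, k, i, hk, hi, rfl, rfl⟩
    exact ⟨d, hd, rfl, (DyckTile.mem_boxes_zig hk _ _).2 (.inr ⟨i, hi, rfl, rfl⟩)⟩

/-- A non-trivial tile not at the bottom lies above a tile two rows below. -/
lemma link_down (h : IsCoverInclusiveTiling n D) {m y : ℤ} (hl : tilingLink D m y) (hy : 2 ≤ y) :
    tilingLink D m (y - 2) := by
  obtain ⟨d, hd, k, i, hk, hi, rfl, rfl⟩ := h.link_iff.1 hl
  have ht := (DyckTile.mem_boxes_zig hk (d.x + 2 * i + 1) (d.y + 1)).2 (.inr ⟨i, hi, rfl, rfl⟩)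
  have hb := (DyckTile.mem_boxes_zig hk (d.x + 2 * i) d.y).2 (.inl ⟨i, hi.le, rfl, rfl⟩)
  rcases h.inclusive d hd with ⟨d', hd', hsub⟩ | hlow
  · obtain ⟨k', hk'⟩ := h.exists_eq_zig hd'
    have ht' := hsub _ ht
    have hb' := hsub _ hb
    refine ⟨d', hd', ?_, by convert ht' using 2; ring⟩
    rcases (DyckTile.mem_boxes_zig hk' _ _).1 ht' with ⟨_, _, _, _⟩ | ⟨_, _, _, _⟩ <;>
      rcases (DyckTile.mem_boxes_zig hk' _ _).1 hb' with ⟨_, _, _, _⟩ | ⟨_, _, _, _⟩ <;> omega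
  · have := hlow _ ht
    simp only at this
    omega

lemma link_bounds (h : IsCoverInclusiveTiling n D) {m y : ℤ} (hl : tilingLink D m y) :
    1 ≤ m ∧ 1 ≤ y ∧ m + y ≤ 2 * n - 2 ∧ Even (m + y) := by
  obtain ⟨d, hd, k, i, hk, hi, rfl, rfl⟩ := h.link_iff.1 hl
  have h1 := h.mem_region hd
    ((DyckTile.mem_boxes_zig hk (d.x + 2 * i) d.y).2 (.inl ⟨i, hi.le, rfl, rfl⟩))
  have h2 := h.mem_region hd
    ((DyckTile.mem_boxes_zig hk (d.x + 2 * (i + 1 : ℕ)) d.y).2 (.inl ⟨i + 1, hi, rfl, rfl⟩))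
  simp only [region, Set.mem_ofPred_eq, Int.odd_iff] at h1 h2
  rw [Int.even_iff]
  push_cast at h2
  omega

/-- Moving down by two from an even row would end in a link in row 0, which is outside the region.
-/
lemma link_odd (h : IsCoverInclusiveTiling n D) {m : ℤ} (N : ℕ) :
    ∀ y : ℤ, y ≤ N → tilingLink D m y → Odd y := by
  induction N with
  | zero => intro y hy hl; have := h.link_bounds hl; omega
  | succ N ih =>
    intro y hy hl
    have hb := h.link_bounds hl
    rcases le_or_gt 2 y with h2 | h2
    · have := ih (y - 2) (by push_cast at hy; omega) (h.link_down hl h2)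
      rw [Int.odd_iff] at *
      omega
    · rw [Int.odd_iff]; omega

lemma linkSystem (h : IsCoverInclusiveTiling n D) : LinkSystem n (tilingLink D) where
  bounds {m y} hl := by
    have h1 := h.link_bounds hl
    have h2 := h.link_odd y.toNat y (Int.self_le_toNat _) hl
    simp only [Int.even_iff, Int.odd_iff] at *
    omega
  down hl hy := h.link_down hl (by omega)

lemma tiledBy (h : IsCoverInclusiveTiling n D) : TiledBy n (tilingLink D) D := by
  have key : ∀ d ∈ D, ∃ k, IsTileOf n (tilingLink D) k d := by
    intro d hd
    obtain ⟨k, hk⟩ := h.exists_eq_zig hd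
    have hl := (DyckTile.mem_boxes_zig hk (d.x + 2 * (0 : ℕ)) d.y).2
      (.inl ⟨0, Nat.zero_le _, rfl, rfl⟩)
    have hr := (DyckTile.mem_boxes_zig hk (d.x + 2 * k) d.y).2 (.inl ⟨k, le_rfl, rfl, rfl⟩)
    refine ⟨k, hk, h.mem_region hd d.corner_mem_boxes, h.mem_region hd hr,
      fun i hi => h.link_iff.2 ⟨d, hd, k, i, hk, hi, rfl, rfl⟩, fun hn => ?_, fun hn => ?_,
      fun hn => ?_⟩
    · obtain ⟨d', hd', k', i', hk', hi', hm, hy⟩ := h.link_iff.1 hn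
      have hb := (DyckTile.mem_boxes_zig hk' (d.x + 2 * (0 : ℕ)) d.y).2
        (.inl ⟨i' + 1, hi', by push_cast; omega, hy⟩)
      obtain rfl := h.eq_of_mem hd hd' hl hb
      omega
    · obtain ⟨d', hd', k', i', hk', hi', hm, hy⟩ := h.link_iff.1 hn
      have hb := (DyckTile.mem_boxes_zig hk' (d.x + 2 * k) d.y).2
        (.inl ⟨i', hi'.le, by omega, hy⟩)
      obtain rfl := h.eq_of_mem hd hd' hr hb
      have := zig_injective (hk.symm.trans hk')
      omega
    · obtain ⟨d', hd', k', i', hk', hi', hm, hy⟩ := h.link_iff.1 hn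
      have hb := (DyckTile.mem_boxes_zig hk' (d.x + 2 * (0 : ℕ)) d.y).2
        (.inr ⟨i', hi', by push_cast; omega, by omega⟩)
      obtain rfl := h.eq_of_mem hd hd' hl hb
      omega
  refine fun d => ⟨key d, fun ⟨k, hk⟩ => ?_⟩
  obtain ⟨d', hd', hb⟩ := h.exists_mem hk.left_mem
  obtain ⟨k', hk'⟩ := key d' hd'
  rwa [hk.eq_of_mem h.linkSystem hk' d.corner_mem_boxes hb]

end IsCoverInclusiveTiling

/-! ### Trajectories and the Lehmer code. -/

section Trajectory

variable {n : ℕ} {L : ℤ → ℤ → Prop} {D : Finset DyckTile} {d d' : DyckTile} {k : ℕ}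

lemma LinkSystem.exists_tile_start (hL : LinkSystem n L) {X Y : ℤ}
    (hr : (X, Y) ∈ region n) (hn : ¬ L X (Y - 1)) (hl : ¬ L (X - 1) Y) :
    ∃ k d, IsTileOf n L k d ∧ d.x = X ∧ d.y = Y := by
  obtain ⟨k, d, i, hd, hi, hX, hY⟩ := hL.exists_tile_bottom hr hn
  rcases Nat.eq_zero_or_pos i with rfl | hpos
  · exact ⟨k, d, hd, by simp [hX], hY.symm⟩
  · refine absurd ?_ hl
    convert hd.link (i - 1) (by omega) using 1
    omega

/-- The trajectory of the label `i + 1` passes through `d`. -/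
def Reaches (D : Finset DyckTile) (i : Fin n) (d : DyckTile) : Prop :=
  ∃ d₀ ∈ D, d₀.x = 0 ∧ d₀.y = 2 * ((n : ℤ) - (i : ℤ)) - 1 ∧ Relation.ReflTransGen (Step D) d₀ d

lemma Reaches.step {i : Fin n} (h : Reaches D i d) (hs : Step D d d') : Reaches D i d' := by
  obtain ⟨d₀, h0, h1, h2, h3⟩ := h
  exact ⟨d₀, h0, h1, h2, h3.tail hs⟩

lemma TiledBy.step (hD : TiledBy n L D) {k' : ℕ} (h : IsTileOf n L k d) (h' : IsTileOf n L k' d')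
    (hx : d'.x = d.x + 2 * k + 1) (hy : d'.y = d.y - 1) : Step D d d' :=
  ⟨(hD d).2 ⟨k, h⟩, (hD d').2 ⟨k', h'⟩, by
    rw [h.exit_eq, DyckTile.entry]; ext <;> simp only <;> omega⟩

lemma TiledBy.right_unique_step (hL : LinkSystem n L) (hD : TiledBy n L D) :
    Relator.RightUnique (Step D) := by
  rintro a b c ⟨_, hb, hab⟩ ⟨_, hc, hac⟩
  obtain ⟨kb, hkb⟩ := (hD b).1 hb
  obtain ⟨kc, hkc⟩ := (hD c).1 hc
  have he : b.entry = c.entry := hab.symm.trans hac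
  simp only [DyckTile.entry, Prod.mk.injEq] at he
  refine hkb.eq_of_mem hL hkc b.corner_mem_boxes ?_
  rw [show b.x = c.x by omega, he.2]
  exact c.corner_mem_boxes

/-- Exits move to the right along a trajectory. -/
lemma exit_le_of_reflTransGen (h : Relation.ReflTransGen (Step D) d d') :
    d.exit.1 ≤ d'.exit.1 := by
  induction h with
  | refl => exact le_rfl
  | tail _ hs ih =>
    refine ih.trans ?_
    rw [hs.2.2]
    simp only [DyckTile.entry, DyckTile.exit]
    omega

/-- Steps are deterministic, so a reached tile lies on the one path to the terminal tile; exits only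
move right along it. -/
lemma TiledBy.exit_le_end (hL : LinkSystem n L) (hD : TiledBy n L D) {i : Fin n} {u : ℤ × ℤ}
    (hu : TrajectoryEndsAt n D i u) (hd : Reaches D i d) : d.exit.1 ≤ u.1 := by
  obtain ⟨a, ha, hax, hay, e, hae, rfl, he⟩ := hu
  obtain ⟨a', ha', hax', hay', had⟩ := hd
  have haa : a = a' := by
    obtain ⟨k, hk⟩ := (hD a).1 ha
    obtain ⟨k', hk'⟩ := (hD a').1 ha'
    refine hk.eq_of_mem hL hk' a.corner_mem_boxes ?_
    rw [hax, hay, ← hax', ← hay']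
    exact a'.corner_mem_boxes
  subst haa
  rcases Relation.ReflTransGen.total_of_right_unique (hD.right_unique_step hL) hae had with h | h
  · rcases Relation.ReflTransGen.cases_head h with rfl | ⟨c, hc, _⟩
    · exact le_rfl
    · exact absurd hc.2.2.symm (he c hc.2.1)
  · exact exit_le_of_reflTransGen h

/-- The number of positions `k' < N` with a value larger than the value at `k`. -/
def rankAbove (π : Equiv.Perm (Fin n)) (N : ℕ) (k : Fin n) : ℕ :=
  (Finset.univ.filter fun k' : Fin n => (k' : ℕ) < N ∧ π k < π k').card

/-- The Lehmer code: the number of larger entries to the left of position `k`. -/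
def invCount (π : Equiv.Perm (Fin n)) (k : Fin n) : ℕ := rankAbove π k k

lemma rankAbove_self (π : Equiv.Perm (Fin n)) (k : Fin n) : rankAbove π n k = n - 1 - π k := by
  rw [rankAbove, ← Fin.card_Ioi, ← Finset.card_map (s := Finset.Ioi (π k)) π.symm.toEmbedding]
  congr 1
  ext k'
  simp [Finset.mem_map_equiv]

lemma rankAbove_succ (π : Equiv.Perm (Fin n)) (k k₀ : Fin n) :
    rankAbove π (k₀ + 1) k = rankAbove π k₀ k + if π k < π k₀ then 1 else 0 := by
  classical
  have : (Finset.univ.filter fun k' : Fin n => (k' : ℕ) < k₀ + 1 ∧ π k < π k') =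
      (Finset.univ.filter fun k' : Fin n => (k' : ℕ) < k₀ ∧ π k < π k') ∪
        if π k < π k₀ then {k₀} else ∅ := by
    ext k'
    split_ifs with h
    · simp only [Finset.mem_filter_univ, Finset.mem_union, Finset.mem_singleton]
      constructor
      · rintro ⟨h1, h2⟩
        by_cases h3 : k' = k₀
        · exact .inr h3
        · exact .inl ⟨by have := Fin.val_ne_of_ne h3; omega, h2⟩
      · rintro (⟨h1, h2⟩ | rfl)
        · exact ⟨by omega, h2⟩
        · exact ⟨by omega, h⟩
    · simp only [Finset.mem_filter_univ, Finset.union_empty]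
      constructor
      · rintro ⟨h1, h2⟩
        refine ⟨?_, h2⟩
        have : k' ≠ k₀ := fun h3 => h (h3 ▸ h2)
        have := Fin.val_ne_of_ne this
        omega
      · rintro ⟨h1, h2⟩
        exact ⟨by omega, h2⟩
  rw [rankAbove, this, Finset.card_union_of_disjoint]
  · congr 1
    split_ifs <;> simp
  · split_ifs <;> simp

lemma rankAbove_mono (π : Equiv.Perm (Fin n)) {N : ℕ} {k k' : Fin n} (h : π k ≤ π k') :
    rankAbove π N k' ≤ rankAbove π N k :=
  Finset.card_le_card fun x hx => by
    simp only [Finset.mem_filter_univ] at *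
    exact ⟨hx.1, h.trans_lt hx.2⟩

lemma rankAbove_strict (π : Equiv.Perm (Fin n)) {N : ℕ} {k k' : Fin n} (h : π k < π k')
    (hk : k' < N) : rankAbove π N k' < rankAbove π N k := by
  refine Finset.card_lt_card ⟨fun x hx => ?_, fun hs => ?_⟩
  · simp only [Finset.mem_filter_univ] at *
    exact ⟨hx.1, h.trans hx.2⟩
  · have := @hs k' (by simpa using ⟨hk, h⟩)
    simp at this

/-- The trajectory continues to the next odd row below if it meets no link. -/
lemma TiledBy.reaches_below (hL : LinkSystem n L) (hD : TiledBy n L D) {i : Fin n} {j r : ℕ}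
    (hr : Reaches D i d) (hd : IsTileOf n L k d) (hx : d.x + 2 * k = 2 * j) (hy : d.y = 2 * r + 1)
    (hpos : 0 < r) (hn : ¬ L (2 * j + 1) (2 * r - 1)) :
    ∃ e, Reaches D i e ∧ IsTileOf n L 0 e ∧ e.x = 2 * j + 1 ∧ e.y = 2 * r := by
  have hreg := hd.right_mem
  rw [hx, hy] at hreg
  simp only [region, Set.mem_ofPred_eq, Int.odd_iff] at hreg
  have heven : ∀ m, ¬ L m (2 * r) := fun m h => by
    have := (hL.bounds h).2.2.2.2
    rw [Int.odd_iff] at this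
    omega
  obtain ⟨k', e, he, hex, hey⟩ := hL.exists_tile_start (X := 2 * j + 1) (Y := 2 * r) (by
    simp only [region, Set.mem_ofPred_eq, Int.odd_iff]; omega) hn (heven _)
  have hk' : k' = 0 := by
    by_contra h0
    have := he.link 0 (by omega)
    rw [hey] at this
    exact heven _ this
  subst hk'
  exact ⟨e, hr.step (hD.step hd he (by omega) (by omega)), he, hex, hey⟩

lemma IsTileOf.eq_right_of_not_link (hd : IsTileOf n L k d) {i : ℕ} (hi : i ≤ k) {X Y : ℤ}
    (hX : X = d.x + 2 * i) (hY : Y = d.y) (hn : ¬ L (X + 1) Y) : i = k := by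
  by_contra h
  apply hn
  rw [hX, hY]
  exact hd.link i (by omega)

/-- The row of a trajectory at abscissa `2j` encodes how many of the first `n - j` positions carry a
larger value. Only the columns already crossed, those of the positions from `n - j` on, have to
follow the code; this makes the lemma usable inside the induction of `TiledBy.code_eq`. -/
lemma TiledBy.reaches_column (hL : LinkSystem n L) (hD : TiledBy n L D) (π : Equiv.Perm (Fin n))
    (j : ℕ) (hcode : ∀ q : Fin n, n ≤ q + j → ∀ r : ℕ,
      (L (2 * ((n : ℤ) - (q : ℕ)) - 1) (2 * r + 1) ↔ r < invCount π q))
    (q : Fin n) (hq : q + j < n) :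
    ∃ k d i, Reaches D (π q) d ∧ IsTileOf n L k d ∧ i ≤ k ∧ (2 * j : ℤ) = d.x + 2 * (i : ℕ) ∧
      d.y = 2 * rankAbove π (n - j) q + 1 := by
  induction j with
  | zero =>
    have hq' := (π q).isLt
    obtain ⟨k, d, hd, hx, hy⟩ := hL.exists_tile_start (X := 0)
      (Y := 2 * ((n : ℤ) - (π q : ℕ)) - 1) (by
        simp only [region, Set.mem_ofPred_eq, Int.odd_iff]; omega)
        (fun h => by have := hL.bounds h; omega) (fun h => by have := hL.bounds h; omega)
    refine ⟨k, d, 0, ⟨d, (hD d).2 ⟨k, hd⟩, hx, hy, .refl⟩, hd, by omega, by simp [hx], ?_⟩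
    rw [hy, Nat.sub_zero, rankAbove_self]
    omega
  | succ j ih =>
    obtain ⟨k, d, i, hr, hd, hi, hX, hY⟩ := ih (fun q hq => hcode q (by omega)) (by omega)
    set q₀ : Fin n := ⟨n - j - 1, by omega⟩ with hq₀
    have hc := hcode q₀ (by simp [hq₀]; omega)
    have hcol : 2 * ((n : ℤ) - (q₀ : ℕ)) - 1 = 2 * j + 1 := by simp [hq₀]; omega
    rw [hcol] at hc
    have hne : π q₀ ≠ π q := fun h => by
      have := congrArg Fin.val (π.injective h)
      simp [hq₀] at this
      omega
    have e1 : n - j = q₀ + 1 := by simp [hq₀]; omega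
    have e2 : n - (j + 1) = q₀ := by simp [hq₀]; omega
    have hs := rankAbove_succ π q q₀
    rw [e1] at hY
    rw [e2]
    -- Removing position `q₀` leaves the rank unchanged if its value is smaller, and then a link
    -- carries the trajectory across. If its value is larger, the rank drops by one: the stack of
    -- links is too low, and the trajectory descends through the trivial tile `e`.
    rcases lt_or_gt_of_ne hne with hlt | hlt
    · rw [if_neg (not_lt_of_gt hlt)] at hs
      have hst : rankAbove π q₀ q < invCount π q₀ :=
        rankAbove_strict π hlt (by simp [hq₀]; omega)
      have hlink := (hc _).2 hst
      refine ⟨k, d, i + 1, hr, hd, ?_, by push_cast; omega, by omega⟩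
      by_contra hgt
      obtain rfl : i = k := by omega
      apply hd.not_link_right
      convert hlink using 1 <;> omega
    · rw [if_pos hlt] at hs
      have hge : invCount π q₀ ≤ rankAbove π q₀ q := rankAbove_mono π hlt.le
      have hn1 := (not_congr (hc (rankAbove π q₀ q + 1))).2 (by omega)
      have hn2 := (not_congr (hc (rankAbove π q₀ q))).2 (by omega)
      obtain rfl := hd.eq_right_of_not_link hi hX (Y := 2 * (rankAbove π q₀ q + 1 : ℕ) + 1)
        (by omega) hn1
      obtain ⟨e, her, he, hex, hey⟩ := hD.reaches_below hL hr hd hX.symm (hY.trans (by rw [hs]))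
        (by omega) (by convert hn2 using 2; push_cast; ring)
      have hreg := he.left_mem
      rw [hex, hey] at hreg
      simp only [region, Set.mem_ofPred_eq, Int.odd_iff] at hreg
      obtain ⟨k', f, hf, hfx, hfy⟩ := hL.exists_tile_start (X := 2 * j + 2)
        (Y := 2 * rankAbove π q₀ q + 1) (by
          simp only [region, Set.mem_ofPred_eq, Int.odd_iff]; push_cast at hreg; omega)
          (fun h => by
            have := (hL.bounds h).2.2.2.2
            rw [Int.odd_iff] at this
            omega) (by convert hn2 using 2; ring)
      exact ⟨k', f, 0, her.step (hD.step he hf (by push_cast; omega) (by omega)), hf, by omega,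
        by push_cast; omega, hfy⟩

/-- The links of the tiling with permutation `π`. -/
def permLink (π : Equiv.Perm (Fin n)) (m y : ℤ) : Prop :=
  ∃ q : Fin n, ∃ r : ℕ, r < invCount π q ∧ m = 2 * ((n : ℤ) - (q : ℕ)) - 1 ∧ y = 2 * r + 1

lemma permLink_iff (π : Equiv.Perm (Fin n)) (q : Fin n) (r : ℕ) :
    permLink π (2 * ((n : ℤ) - (q : ℕ)) - 1) (2 * r + 1) ↔ r < invCount π q := by
  constructor
  · rintro ⟨q', r', h, h1, h2⟩
    obtain rfl : q = q' := Fin.ext (by omega)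
    obtain rfl : r = r' := by omega
    exact h
  · intro h
    exact ⟨q, r, h, rfl, rfl⟩

lemma invCount_le (π : Equiv.Perm (Fin n)) (q : Fin n) : invCount π q ≤ q := by
  have : (Finset.univ.filter fun k' : Fin n => (k' : ℕ) < q ∧ π q < π k') ⊆ Finset.Iio q :=
    fun x hx => by simp only [Finset.mem_filter_univ, Finset.mem_Iio] at *; exact hx.1
  exact (Finset.card_le_card this).trans_eq (Fin.card_Iio q)

lemma linkSystem_permLink (π : Equiv.Perm (Fin n)) : LinkSystem n (permLink π) where
  bounds := by
    rintro m y ⟨q, r, h, rfl, rfl⟩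
    have := invCount_le π q
    have := q.isLt
    simp only [Int.odd_iff]
    omega
  down := by
    rintro m y ⟨q, r, h, rfl, rfl⟩ hy
    exact ⟨q, r - 1, by omega, rfl, by omega⟩

/-- In its own column the trajectory arrives just above the stack of links: no link carries it on,
and the next box is the top box of the highest link, or lies outside the region if the stack is
empty. -/
lemma TiledBy.hasPermutation {π : Equiv.Perm (Fin n)} (hD : TiledBy n (permLink π) D) :
    HasPermutation D π := by
  intro q
  have hL := linkSystem_permLink π
  have hq := q.isLt
  obtain ⟨k, d, i, hr, hd, hi, hX, hY⟩ := hD.reaches_column hL π (n - 1 - q)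
    (fun q _ r => permLink_iff π q r) q (by omega)
  have e1 : n - (n - 1 - q) = (q : ℕ) + 1 := by omega
  rw [e1, rankAbove_succ, if_neg (lt_irrefl _), add_zero] at hY
  have hcol : 2 * ((n : ℤ) - (q : ℕ)) - 1 = 2 * (n - 1 - q : ℕ) + 1 := by omega
  have hc := permLink_iff π q
  rw [hcol] at hc
  have hn := (not_congr (hc (invCount π q))).2 (lt_irrefl _)
  obtain rfl := hd.eq_right_of_not_link hi hX hY.symm hn
  obtain ⟨d₀, h0, h1, h2, h3⟩ := hr
  refine ⟨d.exit, ⟨d₀, h0, h1, h2, d, h3, rfl, fun d' hd' he => ?_⟩, ?_⟩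
  · obtain ⟨k', hk'⟩ := (hD d').1 hd'
    rw [hd.exit_eq] at he
    simp only [DyckTile.entry, Prod.mk.injEq] at he
    have hreg := hk'.left_mem.2.1
    simp only at hreg
    apply hk'.not_top
    have := (hc (invCount π q - 1)).2 (by unfold invCount at *; omega)
    unfold invCount at *
    convert this using 1 <;> omega
  · rw [hd.exit_eq]
    simp only
    omega

/-- Induction over the columns from left to right. The columns already known determine the row in
which the trajectory of `π q` arrives; since it has to stop there, the stack of links must end
exactly below that row. -/
lemma TiledBy.code_eq (hL : LinkSystem n L) (hD : TiledBy n L D) {π : Equiv.Perm (Fin n)}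
    (hπ : HasPermutation D π) (j : ℕ) : ∀ q : Fin n, n ≤ q + j → ∀ r : ℕ,
      (L (2 * ((n : ℤ) - (q : ℕ)) - 1) (2 * r + 1) ↔ r < invCount π q) := by
  induction j with
  | zero => intro q hq; have := q.isLt; omega
  | succ j ih =>
    intro q hq
    by_cases hq' : n ≤ q + j
    · exact ih q hq'
    obtain ⟨k, d, i, hr, hd, hi, hX, hY⟩ := hD.reaches_column hL π j ih q (by omega)
    have e1 : n - j = (q : ℕ) + 1 := by omega
    rw [e1, rankAbove_succ, if_neg (lt_irrefl _), add_zero] at hY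
    change d.y = 2 * (invCount π q : ℕ) + 1 at hY
    have hcol : 2 * ((n : ℤ) - (q : ℕ)) - 1 = 2 * j + 1 := by omega
    rw [hcol]
    obtain ⟨u, hu, hux⟩ := hπ q
    have hle := hD.exit_le_end hL hu hr
    rw [hd.exit_eq] at hle
    simp only at hle
    have hik : i = k := by omega
    subst hik
    have hdown : ∀ s r : ℕ, L (2 * j + 1) (2 * (r + s : ℕ) + 1) → L (2 * j + 1) (2 * r + 1) := by
      intro s
      induction s with
      | zero => intro r h; exact h
      | succ s ihs =>
        intro r h
        apply ihs
        have := hL.down h (by push_cast; omega)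
        convert this using 1
        push_cast; ring
    intro r
    constructor
    · intro h
      by_contra hlt
      have := hdown (r - invCount π q) (invCount π q) (by
        convert h using 3; omega)
      apply hd.not_link_right
      rwa [← hX, hY]
    · intro h
      -- Without this link the trajectory would enter a trivial tile whose exit is too far right.
      have : L (2 * j + 1) (2 * invCount π q - 1) := by
        by_contra hn
        obtain ⟨e, her, he, hex, hey⟩ := hD.reaches_below hL hr hd hX.symm hY (by omega) hn
        have := hD.exit_le_end hL hu her
        rw [he.exit_eq] at this
        simp only at this
        omega
      apply hdown (invCount π q - 1 - r)
      convert this using 1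
      push_cast [h]
      omega

lemma TiledBy.link_eq_permLink (hL : LinkSystem n L) (hD : TiledBy n L D)
    {π : Equiv.Perm (Fin n)} (hπ : HasPermutation D π) : L = permLink π := by
  have key := hD.code_eq hL hπ n
  ext m y
  constructor
  · intro h
    have hb := hL.bounds h
    simp only [Int.odd_iff] at hb
    obtain ⟨q, hq⟩ : ∃ q : Fin n, m = 2 * ((n : ℤ) - (q : ℕ)) - 1 :=
      ⟨⟨(n - (m + 1) / 2).toNat, by omega⟩, by simp only; omega⟩
    obtain ⟨r, hr⟩ : ∃ r : ℕ, y = 2 * r + 1 := ⟨((y - 1) / 2).toNat, by omega⟩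
    subst hq hr
    exact ⟨q, r, (key q (by omega) r).1 h, rfl, rfl⟩
  · rintro ⟨q, r, h, rfl, rfl⟩
    exact (key q (by omega) r).2 h

end Trajectory

theorem existsUnique_tiling {n : ℕ} (π : Equiv.Perm (Fin n)) :
    ∃! D : Finset DyckTile, IsCoverInclusiveTiling n D ∧ HasPermutation D π := by
  obtain ⟨D, hD⟩ := exists_tiledBy n (permLink π)
  refine ⟨D, ⟨hD.isCoverInclusiveTiling (linkSystem_permLink π), hD.hasPermutation⟩, ?_⟩
  rintro D' ⟨h, h'⟩
  ext d
  rw [hD d, h.tiledBy d, h.tiledBy.link_eq_permLink h.linkSystem h']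

/-! ### Non-trivial tiles and descents. -/

section Descents

variable {n : ℕ} {π : Equiv.Perm (Fin n)}

/-- The descents `i < n` of `π`, counted from `0`. -/
def descents (π : Equiv.Perm (Fin n)) : Finset (Fin n) :=
  Finset.univ.filter fun i : Fin n => ∃ h : (i : ℕ) + 1 < n, π ⟨(i : ℕ) + 1, h⟩ < π i

lemma mem_descents {i : Fin n} :
    i ∈ descents π ↔ ∃ h : (i : ℕ) + 1 < n, π ⟨(i : ℕ) + 1, h⟩ < π i := by
  simp [descents]

/-- An earlier value strictly between `π i'` and `π i` would form a 231 with them, so `π i` itself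
is the only new larger entry. -/
lemma invCount_succ_of_descent (hπ : Avoids231 π) {i i' : Fin n} (hi : (i' : ℕ) = i + 1)
    (hd : π i' < π i) : invCount π i' = invCount π i + 1 := by
  rw [invCount, hi, rankAbove_succ, if_pos hd, invCount, rankAbove, rankAbove]
  congr 2
  ext q
  simp only [Finset.mem_filter_univ, and_congr_right_iff]
  intro hq
  refine ⟨fun h => ?_, fun h => hd.trans h⟩
  by_contra hle
  refine hπ ⟨q, i, i', hq, Fin.lt_def.2 (by omega), h, lt_of_le_of_ne (not_lt.1 hle) fun he => ?_⟩
  have := congrArg Fin.val (π.injective he)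
  omega

lemma invCount_succ_of_ascent {i i' : Fin n} (hi : (i' : ℕ) = i + 1)
    (hd : π i < π i') : invCount π i' ≤ invCount π i := by
  rw [invCount, hi, rankAbove_succ, if_neg (not_lt_of_gt hd)]
  exact rankAbove_mono π hd.le

/-- The positions after a descent with larger code entries end just before the larger values. -/
lemma apply_add_invCount_eq (hπ : Avoids231 π) {i : Fin n} {e : ℕ} (he : e < n) (hie : i ≤ e)
    (h1 : ∀ q : Fin n, i < q → q ≤ e → invCount π i < invCount π q)
    (h2 : ∀ q : Fin n, (q : ℕ) = e + 1 → invCount π q ≤ invCount π i) :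
    (π i : ℕ) + invCount π i = e := by
  -- If `π q` were larger, every entry counted for `q` would, by induction, already be counted for
  -- `i`, contradicting `h1`.
  have low : ∀ N : ℕ, ∀ q : Fin n, (q : ℕ) ≤ N → i < q → (q : ℕ) ≤ e → π q < π i := by
    intro N
    induction N with
    | zero => intro q hq hiq _; rw [Fin.lt_def] at hiq; omega
    | succ N ih =>
      intro q hq hiq hqe
      by_contra hle
      refine (h1 q hiq hqe).not_ge ?_
      rw [invCount, rankAbove, invCount, rankAbove]
      refine Finset.card_le_card fun x hx => ?_
      simp only [Finset.mem_filter_univ] at hx ⊢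
      have hix : π i < π x := (not_lt.1 hle).trans_lt hx.2
      refine ⟨?_, hix⟩
      by_contra hxi
      rcases (not_lt.1 hxi).eq_or_lt with h | h
      · exact hix.ne (congrArg π (Fin.ext h))
      · exact (ih x (by omega) h (by omega)).not_gt hix
  -- The code bound `h2` settles position `e + 1`; a later smaller value would complete a 231 with
  -- positions `i` and `e + 1`.
  have high : ∀ q : Fin n, e < q → π i < π q := by
    have hs : ∀ q : Fin n, (q : ℕ) = e + 1 → π i < π q := by
      intro q hq
      by_contra hle
      have hlt : π q < π i := lt_of_le_of_ne (not_lt.1 hle) fun h => by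
        have := congrArg Fin.val (π.injective h)
        omega
      have hc := h2 q hq
      rw [invCount, hq] at hc
      refine (rankAbove_strict π (N := e + 1) hlt (by omega)).not_ge (hc.trans ?_)
      rw [invCount, rankAbove, rankAbove]
      refine Finset.card_le_card fun x hx => ?_
      simp only [Finset.mem_filter_univ] at hx ⊢
      exact ⟨by omega, hx.2⟩
    intro q hq
    rcases Nat.eq_or_lt_of_le (Nat.succ_le_of_lt hq) with h | h
    · exact hs q h.symm
    · by_contra hle
      have hlt : π q < π i := lt_of_le_of_ne (not_lt.1 hle) fun h => by
        have := congrArg Fin.val (π.injective h)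
        omega
      have hq' := q.isLt
      exact hπ ⟨i, ⟨e + 1, by omega⟩, q, Fin.lt_def.2 (by simp only; omega),
        Fin.lt_def.2 (by simp only; omega), hlt, hs _ rfl⟩
  have hcard : rankAbove π n i = invCount π i + (n - 1 - e) := by
    rw [← Fin.card_Ioi (⟨e, he⟩ : Fin n), invCount, rankAbove, rankAbove,
      ← Finset.card_union_of_disjoint]
    · congr 1
      ext q
      simp only [Finset.mem_filter_univ, Finset.mem_union, Finset.mem_Ioi, Fin.lt_def (a := ⟨e, he⟩)]
      constructor
      · rintro ⟨_, hq⟩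
        rcases lt_or_ge e q with h | h
        · exact .inr h
        · left
          refine ⟨?_, hq⟩
          by_contra hqi
          rcases (not_lt.1 hqi).eq_or_lt with h' | h'
          · exact hq.ne (congrArg π (Fin.ext h'))
          · exact (low q q le_rfl h' h).not_gt hq
      · rintro (⟨_, h⟩ | h)
        · exact ⟨q.isLt, h⟩
        · exact ⟨q.isLt, high q h⟩
    · rw [Finset.disjoint_left]
      intro q hq hq'
      simp only [Finset.mem_filter_univ, Finset.mem_Ioi, Fin.lt_def (a := ⟨e, he⟩)] at hq hq'
      omega
  rw [rankAbove_self] at hcard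
  have := (π i).isLt
  omega

/-- At the right end the code jumps above its previous entry, which only a descent allows; the jump
by one fixes the row. The left end is the first column after `i` whose code does not exceed that of
`i`, and `apply_add_invCount_eq` converts it into the value `π i`. -/
lemma IsTileOf.exists_descent (hπ : Avoids231 π) {k : ℕ} {d : DyckTile}
    (hd : IsTileOf n (permLink π) k d) (hk : 0 < k) :
    ∃ i ∈ descents π, d.x + 2 * k = 2 * ((n : ℤ) - 1 - (i : ℕ)) ∧ d.y = 2 * invCount π i + 1 ∧
      d.x + 2 * invCount π i + 2 = 2 * ((n : ℤ) - (π i : ℕ)) := by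
  have hl := hd.link (k - 1) (by omega)
  obtain ⟨i', r, hr, hm, hy⟩ := hl
  have hreg := hd.left_mem
  simp only [region, Set.mem_ofPred_eq, Int.odd_iff] at hreg
  have hpos : 0 < (i' : ℕ) := by have := invCount_le π i'; omega
  have hi'n := i'.isLt
  obtain ⟨i, hi⟩ : ∃ i : Fin n, (i' : ℕ) = i + 1 := ⟨⟨i' - 1, by omega⟩, by simp only; omega⟩
  have hnr : invCount π i ≤ r := by
    by_contra hlt
    apply hd.not_link_right
    exact ⟨i, r, not_le.1 hlt, by omega, hy⟩
  have hdesc : π i' < π i := by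
    by_contra hle
    have hlt : π i < π i' := lt_of_le_of_ne (not_lt.1 hle) fun h => by
      have := congrArg Fin.val (π.injective h)
      omega
    have := invCount_succ_of_ascent hi hlt
    omega
  have hs := invCount_succ_of_descent hπ hi hdesc
  obtain rfl : r = invCount π i := by omega
  have hmem : i ∈ descents π := mem_descents.2 ⟨by omega, by convert hdesc; exact hi.symm⟩
  obtain ⟨e, he⟩ : ∃ e : ℕ, d.x = 2 * ((n : ℤ) - 1 - e) :=
    ⟨(n - 1 - d.x / 2).toNat, by omega⟩
  have hval := apply_add_invCount_eq hπ (i := i) (e := e) (by omega) (by omega)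
    (fun q hiq hqe => by
      rw [Fin.lt_def] at hiq
      rw [← permLink_iff]
      convert hd.link (e - q) (by omega) using 1
      · omega
      · exact hy.symm)
    (fun q hq => by
      rw [← not_lt, ← permLink_iff]
      convert hd.not_link_left using 2
      · omega
      · exact hy.symm)
  exact ⟨i, hmem, by omega, hy, by omega⟩

lemma exists_tile_of_descent (hπ : Avoids231 π) {i : Fin n} (hi : i ∈ descents π) :
    ∃ d k, IsTileOf n (permLink π) k d ∧ 0 < k ∧ d.x + 2 * k = 2 * ((n : ℤ) - 1 - (i : ℕ)) ∧
      d.y = 2 * invCount π i + 1 := by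
  obtain ⟨hn, hd⟩ := mem_descents.1 hi
  have hs := invCount_succ_of_descent hπ (i := i) rfl hd
  have hle := invCount_le π i
  have hL := linkSystem_permLink π
  obtain ⟨k, d, j, hd, hj, hX, hY⟩ := hL.exists_tile_bottom
    (X := 2 * ((n : ℤ) - 1 - (i : ℕ))) (Y := 2 * invCount π i + 1)
    (by simp only [region, Set.mem_ofPred_eq, Int.odd_iff]; omega)
    (fun h => by
      have := (hL.bounds h).2.2.2.2
      rw [Int.odd_iff] at this
      omega)
  have hjk := hd.eq_right_of_not_link hj hX hY (by
    convert (not_congr (permLink_iff π i (invCount π i))).2 (lt_irrefl _) using 2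
    ring)
  subst hjk
  refine ⟨d, j, hd, ?_, hX.symm, hY.symm⟩
  by_contra h0
  apply hd.not_link_left
  rw [← hY]
  convert (permLink_iff π ⟨i + 1, hn⟩ (invCount π i)).2 (by omega) using 1
  simp only
  omega

lemma IsTileOf.maj_eq {L : ℤ → ℤ → Prop} {k : ℕ} {d : DyckTile} (hd : IsTileOf n L k d)
    (hk : 0 < k) : d.maj = k + 1 + d.x + (d.y - 1) / 2 := by
  have hne : d.path ≠ 0 := by
    rw [hd.path_eq]
    exact fun h => hk.ne' (zig_injective (a₂ := 0) h)
  rw [DyckTile.maj, if_neg hne, DyckTile.size, if_neg hne, DyckTile.card_boxes, hd.path_eq,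
    length_zig]
  push_cast
  ring

theorem TiledBy.tilingMaj_eq (hπ : Avoids231 π) {D : Finset DyckTile}
    (hD : TiledBy n (permLink π) D) :
    tilingMaj D = ∑ i ∈ descents π, (((n : ℚ) - 1 - (i : ℕ)) + ((n : ℚ) - (π i : ℕ))) := by
  classical
  have hL := linkSystem_permLink π
  have : Nonempty DyckTile := ⟨⟨0, 0, 0⟩⟩
  choose! T K hT using fun i (hi : i ∈ descents π) => exists_tile_of_descent hπ hi
  have hpath : ∀ {k d}, IsTileOf n (permLink π) k d → (d.path ≠ 0 ↔ 0 < k) := by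
    intro k d hd
    rw [hd.path_eq, Nat.pos_iff_ne_zero]
    exact not_congr (zig_injective.eq_iff (b := 0))
  have hfil : tilingMaj D = ∑ d ∈ D.filter (fun d => d.path ≠ 0), d.maj := by
    rw [tilingMaj, Finset.sum_filter_of_ne]
    intro d _ hne h0
    exact hne (by rw [DyckTile.maj, if_pos h0])
  rw [hfil]
  symm
  refine Finset.sum_bij (fun i _ => T i) ?_ ?_ ?_ ?_
  · intro i hi
    obtain ⟨h1, h2, -⟩ := hT i hi
    exact Finset.mem_filter.2 ⟨(hD _).2 ⟨_, h1⟩, (hpath h1).2 h2⟩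
  · intro i hi i' hi' h
    obtain ⟨h1, _, h2, -⟩ := hT i hi
    obtain ⟨h1', _, h2', -⟩ := hT i' hi'
    have hk : K i = K i' := zig_injective (by rw [← h1.path_eq, ← h1'.path_eq, h])
    rw [h, hk] at h2
    exact Fin.ext (by omega)
  · intro d hd
    obtain ⟨hdD, hne⟩ := Finset.mem_filter.1 hd
    obtain ⟨k, hk⟩ := (hD d).1 hdD
    obtain ⟨i, hi, hx, hy, -⟩ := hk.exists_descent hπ ((hpath hk).1 hne)
    obtain ⟨h1, _, h2, h3⟩ := hT i hi
    exact ⟨i, hi, h1.eq_of_bottom hk le_rfl le_rfl (h2.trans hx.symm) (h3.trans hy.symm)⟩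
  · intro i hi
    obtain ⟨h1, hpos, h2, h3⟩ := hT i hi
    obtain ⟨i', hi', hx, hy, hw⟩ := h1.exists_descent hπ hpos
    obtain rfl : i = i' := Fin.ext (by omega)
    rw [h1.maj_eq hpos, h3]
    have hx' : ((T i).x : ℚ) + 2 * K i = 2 * ((n : ℚ) - 1 - (i : ℕ)) := by exact_mod_cast hx
    have hw' : ((T i).x : ℚ) + 2 * invCount π i + 2 = 2 * ((n : ℚ) - (π i : ℕ)) := by
      exact_mod_cast hw
    push_cast
    -- The maj of the tile is half the sum of `hx'` and `hw'`.
    linarith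

end Descents

/-! ### The major index of `ρ(π)`. -/

lemma majorIndex_append_pair (w : List ℕ) (a b : ℕ) :
    majorIndex (w ++ [a] ++ [b]) =
      majorIndex (w ++ [a]) + if b < a then w.length + 1 else 0 := by
  simp only [majorIndex, Finset.sum_filter, List.length_append, List.length_singleton]
  rw [Finset.sum_range_succ, Finset.sum_range_succ, Finset.sum_range_succ _ w.length]
  have h1 : ∀ j ∈ Finset.range w.length,
      (if ∃ h : j + 1 < w.length + 1 + 1,
        (w ++ [a] ++ [b])[j + 1]'(by simpa using h) < (w ++ [a] ++ [b])[j]'(by simp; omega)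
        then j + 1 else 0) =
      (if ∃ h : j + 1 < w.length + 1,
        (w ++ [a])[j + 1]'(by simpa using h) < (w ++ [a])[j]'(by simp; omega)
        then j + 1 else 0) := by
    intro j hj
    rw [Finset.mem_range] at hj
    congr 1
    rw [eq_iff_iff, exists_prop_of_true (by omega), exists_prop_of_true (by omega),
      List.getElem_append_left, List.getElem_append_left (as := w ++ [a])]
  rw [Finset.sum_congr rfl h1]
  simp

lemma majorIndex_append_replicate (w : List ℕ) (a c m : ℕ) (h : a ≤ c) :
    majorIndex (w ++ [a] ++ List.replicate m c) = majorIndex (w ++ [a]) := by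
  induction m generalizing w a with
  | zero => simp
  | succ m ih =>
    rw [show List.replicate (m + 1) c = [c] ++ List.replicate m c from rfl, ← List.append_assoc, ih (w ++ [a]) c le_rfl,
      majorIndex_append_pair, if_neg (not_lt.2 h), add_zero]

lemma majorIndex_block (p q : ℕ) :
    majorIndex (List.replicate (p + 1) 0 ++ List.replicate q 1) = 0 := by
  rw [List.replicate_succ', majorIndex_append_replicate _ _ _ _ zero_le_one,
    ← List.replicate_succ', List.replicate_succ, ← List.singleton_append, ← List.nil_append [0],
    majorIndex_append_replicate _ _ _ _ le_rfl]
  simp [majorIndex]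

lemma majorIndex_append_block (w : List ℕ) (p q : ℕ) :
    majorIndex (w ++ [1] ++ (List.replicate (p + 1) 0 ++ List.replicate q 1)) =
      majorIndex (w ++ [1]) + (w.length + 1) := by
  have h0 : majorIndex (w ++ [1] ++ List.replicate (p + 1) 0) =
      majorIndex (w ++ [1]) + (w.length + 1) := by
    rw [show List.replicate (p + 1) 0 = [0] ++ List.replicate p 0 from rfl, ← List.append_assoc,
      majorIndex_append_replicate _ _ _ _ le_rfl, majorIndex_append_pair, if_pos zero_lt_one]
  rw [← List.append_assoc, ← h0, List.replicate_succ', ← List.append_assoc,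
    majorIndex_append_replicate _ _ _ _ zero_le_one]

/-- Each block `0…01…1` appended on the right creates one descent, at the junction, whose position
is the length of the prefix, `(n - i) + (n - j)` by telescoping. The final pair `(n, n)` has an
empty prefix and contributes 0. The last clause supplies the 1 before the junction. -/
lemma pathWord_spec (n : ℕ) : ∀ (is js : List ℕ) (a b : ℕ), is.length = js.length →
    (a :: is).Pairwise (· < ·) → (b :: js).Pairwise (· < ·) → (∀ x ∈ a :: is, x ≤ n) →
    (∀ x ∈ b :: js, x ≤ n) → n ∈ a :: is → n ∈ b :: js →
    (pathWord a b is js).length = (n - a) + (n - b) ∧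
    majorIndex (pathWord a b is js) =
      (is.map fun i => n - i).sum + (js.map fun j => n - j).sum ∧
    (is ≠ [] → ∃ w, pathWord a b is js = w ++ [1])
  | [], [], a, b, _, _, _, _, _, ha, hb => by
    simp only [List.mem_singleton] at ha hb
    subst ha
    subst hb
    simp [pathWord, majorIndex]
  | i :: is, j :: js, a, b, hlen, hi, hj, hin, hjn, ha, hb => by
    rw [List.pairwise_cons] at hi hj
    have hai := hi.1 i (by simp)
    have hbj := hj.1 j (by simp)
    have hi' := hin i (by simp)
    have hj' := hjn j (by simp)
    have hmi : n ∈ i :: is := (List.mem_cons.1 ha).resolve_left (by omega)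
    have hmj : n ∈ j :: js := (List.mem_cons.1 hb).resolve_left (by omega)
    obtain ⟨h1, h2, h3⟩ := pathWord_spec n is js i j (by simpa using hlen) hi.2 hj.2
      (fun x hx => hin x (List.mem_cons_of_mem _ hx))
      (fun x hx => hjn x (List.mem_cons_of_mem _ hx)) hmi hmj
    obtain ⟨p, hp⟩ : ∃ p, i - a = p + 1 := ⟨i - a - 1, by omega⟩
    obtain ⟨q, hq⟩ : ∃ q, j - b = q + 1 := ⟨j - b - 1, by omega⟩
    rw [pathWord]
    refine ⟨?_, ?_, fun _ => ?_⟩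
    · simp only [List.length_append, List.length_replicate, h1]
      omega
    · rw [hp]
      by_cases hnil : is = []
      · subst hnil
        obtain rfl : js = [] := by simpa using hlen.symm
        simp only [List.mem_singleton] at hmi hmj
        subst hmi
        subst hmj
        simp [pathWord, majorIndex_block]
      · obtain ⟨w, hw⟩ := h3 hnil
        have hwl := congrArg List.length hw
        rw [h1] at hwl
        simp only [List.length_append, List.length_singleton] at hwl
        rw [hw, majorIndex_append_block, ← hw, h2]
        simp only [List.map_cons, List.sum_cons]
        omega
    · exact ⟨pathWord i j is js ++ (List.replicate (i - a) 0 ++ List.replicate q 1), by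
        rw [hq, List.replicate_succ']; simp⟩

section Rho

variable {n : ℕ} {π : Equiv.Perm (Fin n)}

lemma des_eq (π : Equiv.Perm (Fin n)) :
    des π = insert n ((descents π).image fun i : Fin n => (i : ℕ) + 1) := rfl

/-- For a `231`-avoiding permutation the inverse descents are given by the descent tops. -/
lemma iDes_eq (hπ : Avoids231 π) :
    iDes π = insert n ((descents π).image fun i : Fin n => (π i : ℕ)) := by
  rw [iDes, des_eq]
  congr 1
  ext v
  simp only [Finset.mem_image, mem_descents]
  constructor
  · rintro ⟨j, ⟨h, hlt⟩, rfl⟩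
    set i := π⁻¹ ⟨j + 1, h⟩ with hi
    have hπi : π i = ⟨j + 1, h⟩ := by simp [hi]
    have hlast := (π⁻¹ j).isLt
    rw [Fin.lt_def] at hlt
    have hi1 : (i : ℕ) + 1 < n := by omega
    refine ⟨i, ⟨hi1, ?_⟩, by simp [hπi]⟩
    by_contra hle
    have hne : π i ≠ π ⟨i + 1, hi1⟩ := fun h => by
      have := congrArg Fin.val (π.injective h)
      simp at this
    have hgt : π i < π ⟨i + 1, hi1⟩ := lt_of_le_of_ne (not_lt.1 hle) hne
    -- If the value `j + 1` began an ascent, it, its successor and the later value `j` would form a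
    -- 231.
    refine hπ ⟨i, ⟨i + 1, hi1⟩, π⁻¹ j, Fin.lt_def.2 (by simp), ?_, ?_, hgt⟩
    · refine lt_of_le_of_ne (Fin.le_def.2 (by simp only; omega)) fun h => ?_
      rw [h, hπi] at hgt
      simp [Fin.lt_def] at hgt
    · rw [hπi]
      simp [Fin.lt_def]
  · rintro ⟨i, ⟨h, hlt⟩, rfl⟩
    have hpos : 0 < (π i : ℕ) := by rw [Fin.lt_def] at hlt; omega
    have hin := (π i).isLt
    set j : Fin n := ⟨π i - 1, by omega⟩ with hj
    have hj1 : (j : ℕ) + 1 = π i := by simp only [hj]; omega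
    refine ⟨j, ⟨by omega, ?_⟩, hj1⟩
    have e : (⟨j + 1, by omega⟩ : Fin n) = π i := Fin.ext hj1
    have hinv : π⁻¹ (π i) = i := by simp
    rw [e, hinv]
    by_contra hle
    have hji : π (π⁻¹ j) = j := by simp
    have hlt' : π⁻¹ j < i := lt_of_le_of_ne (not_lt.1 hle) fun h => by
      rw [h] at hji
      have := congrArg Fin.val hji
      omega
    -- If the value just below the descent top came earlier, it would form a 231 with the descent.
    refine hπ ⟨π⁻¹ j, i, ⟨i + 1, h⟩, hlt', Fin.lt_def.2 (by simp), ?_, ?_⟩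
    · rw [hji]
      refine lt_of_le_of_ne (Fin.le_def.2 ?_) fun h' => ?_
      · rw [Fin.lt_def] at hlt; omega
      · have hinv' : π⁻¹ (π ⟨i + 1, h⟩) = ⟨i + 1, h⟩ := by simp
        rw [← h', hinv', Fin.lt_def] at hlt'
        simp only at hlt'
        omega
    · rw [hji, Fin.lt_def]
      omega

lemma sum_map_sort (s : Finset ℕ) (f : ℕ → ℕ) : ((s.sort (· ≤ ·)).map f).sum = ∑ i ∈ s, f i := by
  rw [← List.sum_toFinset f (s.sort_nodup _), Finset.sort_toFinset]

theorem majorIndex_rho (hπ : Avoids231 π) :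
    majorIndex (rho π) = ∑ i ∈ descents π, ((n - (i + 1)) + (n - π i)) := by
  -- For `n = 0` the only element of `des π` is 0, so the strict increase from the initial 0 needed
  -- by `pathWord_spec` fails.
  rcases Nat.eq_zero_or_pos n with rfl | hn
  · have h : ∀ ρ : Equiv.Perm (Fin 0), des ρ = {0} := fun ρ => by simp [des_eq, descents]
    simp [rho, iDes, h, pathWord, majorIndex]
  have hlt : ∀ i ∈ descents π, (i : ℕ) + 1 < n := fun i hi => (mem_descents.1 hi).1
  have hn1 : n ∉ (descents π).image fun i : Fin n => (i : ℕ) + 1 := fun h => by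
    obtain ⟨i, hi, h⟩ := Finset.mem_image.1 h
    have := hlt i hi
    omega
  have hn2 : n ∉ (descents π).image fun i : Fin n => (π i : ℕ) := fun h => by
    obtain ⟨i, hi, h⟩ := Finset.mem_image.1 h
    have := (π i).isLt
    omega
  have inj1 : Function.Injective fun i : Fin n => (i : ℕ) + 1 := fun a b h => Fin.ext (by
    simpa using h)
  have inj2 : Function.Injective fun i : Fin n => (π i : ℕ) := fun a b h =>
    π.injective (Fin.ext h)
  have hpos1 : ∀ x ∈ des π, 0 < x ∧ x ≤ n := by
    intro x hx
    rw [des_eq, Finset.mem_insert, Finset.mem_image] at hx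
    rcases hx with rfl | ⟨i, hi, rfl⟩
    · omega
    · have := hlt i hi
      omega
  have hpos2 : ∀ x ∈ iDes π, 0 < x ∧ x ≤ n := by
    intro x hx
    rw [iDes_eq hπ, Finset.mem_insert, Finset.mem_image] at hx
    rcases hx with rfl | ⟨i, hi, rfl⟩
    · omega
    · obtain ⟨_, h⟩ := mem_descents.1 hi
      have := (π i).isLt
      rw [Fin.lt_def] at h
      omega
  have hcard : (des π).card = (iDes π).card := by
    rw [iDes_eq hπ, des_eq, Finset.card_insert_of_notMem hn1, Finset.card_insert_of_notMem hn2,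
      Finset.card_image_of_injective _ inj1, Finset.card_image_of_injective _ inj2]
  have hspec := (pathWord_spec n ((des π).sort (· ≤ ·)) ((iDes π).sort (· ≤ ·)) 0 0
    (by simpa using hcard)
    (List.pairwise_cons.2 ⟨fun x hx => (hpos1 x (by simpa using hx)).1,
      (Finset.sortedLT_sort _).pairwise⟩)
    (List.pairwise_cons.2 ⟨fun x hx => (hpos2 x (by simpa using hx)).1,
      (Finset.sortedLT_sort _).pairwise⟩)
    (fun x hx => by
      rcases List.mem_cons.1 hx with rfl | h
      · omega
      · exact (hpos1 x (by simpa using h)).2)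
    (fun x hx => by
      rcases List.mem_cons.1 hx with rfl | h
      · omega
      · exact (hpos2 x (by simpa using h)).2)
    (List.mem_cons_of_mem _ (by simp [des_eq]))
    (List.mem_cons_of_mem _ (by simp [iDes_eq hπ]))).2.1
  rw [rho, hspec, sum_map_sort, sum_map_sort, iDes_eq hπ, des_eq, Finset.sum_insert hn1,
    Finset.sum_insert hn2, Finset.sum_image inj1.injOn, Finset.sum_image inj2.injOn,
    Finset.sum_add_distrib]
  simp

end Rho

end DyckTiling

theorem mainTheorem5 (n : ℕ) (π : Equiv.Perm (Fin n)) (hπ : DyckTiling.Avoids231 π) :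
    (∃! D : Finset DyckTiling.DyckTile,
      DyckTiling.IsCoverInclusiveTiling n D ∧ DyckTiling.HasPermutation D π) ∧
    ∀ D : Finset DyckTiling.DyckTile,
      DyckTiling.IsCoverInclusiveTiling n D → DyckTiling.HasPermutation D π →
        DyckTiling.tilingMaj D = (DyckTiling.majorIndex (DyckTiling.rho π) : ℚ) := by
  refine ⟨DyckTiling.existsUnique_tiling π, fun D h h' => ?_⟩
  have hD := h.tiledBy
  rw [hD.link_eq_permLink h.linkSystem h'] at hD
  rw [hD.tilingMaj_eq hπ, DyckTiling.majorIndex_rho hπ, Nat.cast_sum]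
  refine Finset.sum_congr rfl fun i _ => ?_
  rw [Nat.cast_add, Nat.cast_sub i.isLt, Nat.cast_sub (π i).isLt.le]
  push_cast
  ring
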